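/- All graphs are finite and simple. For vertices $u,v$ of a graph $G$ let $d_G(u,v)$ be their distance ($d_G(u,v)=\infty$ if no path joins them), let $\mathrm{diam}(G)$ be the largest distance between two vertices of $G$ (so $\mathrm{diam}(G)=\infty>2$ if $G$ is disconnected), and let $N_G[u]$ be the closed neighborhood of $u$. A set $X\subseteq V(G)$ is an outer general position set of $G$ if for all $u\in X$ and $v\in V(G)$ every shortest $u,v$-path $P$ satisfies $V(P)\cap X\subseteq\{u,v\}$; $\mathrm{gp_o}(G)$ is the largest cardinality of such a set. A vertex $u$ is maximally distant from $v$ if $d_G(v,w)\le d_G(u,v)$ for every neighbor $w$ of $u$; $u$ and $v$ are mutually maximally distant (MMD) if each is maximally distant from the other; $\partial(G)$ is the set of vertices that are MMD with some other vertex. The TF-boundary $\partial_{TF}(G)$ is the set of all $x\in\partial(G)$ for which there is $y\in\partial(G)$ such that $x,y$ are MMD and are not true twins, that is, $N_G[x]\neq N_G[y]$. The strong resolving TF-graph $G'_{SRS}$ has vertex set $\partial_{TF}(G)$, two vertices $x,y$ being adjacent if they are MMD in $G$ and $N_G[x]\ne N_G[y]$. The lexicographic product $G\circ H$ has vertex set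 $V(G)\times V(H)$, with $(g,h)$ and $(g',h')$ adjacent if $gg'\in E(G)$, or $g=g'$ and $hh'\in E(H)$. Further, $K_1+H$ is the graph obtained from $H$ by adding one new vertex adjacent to all vertices of $H$, and $\omega$ denotes the clique number. A vertex is universal if it is adjacent to all other vertices. **Theorem.** Let $G$ be a connected non-complete graph, and let $H$ be a (not necessarily connected) graph of order at least $2$ without universal vertices. (i) If $\mathrm{diam}(H)=2$, then $\mathrm{gp_o}(G\circ H)=\omega(G'_{SRS})\,\mathrm{gp_o}(H)$. (ii) If $\mathrm{diam}(H)>2$, then $\mathrm{gp_o}(G\circ H)=\omega(G'_{SRS})\,\mathrm{gp_o}(K_1+H)$. -/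

import Mathlib

namespace SimpleGraph

/-- `u` and `v` are `X`-positionable: every shortest `u,v`-path meets `X` only in its endpoints
(the endpoints themselves may or may not belong to `X`). -/
def XPositionable {V : Type*} (G : SimpleGraph V) (X : Set V) (u v : V) : Prop :=
  ∀ p : G.Walk u v, p.length = G.dist u v → ∀ x ∈ p.support, x ∈ X → x = u ∨ x = v

/-- Outer general position sets. -/
def IsOuterGeneralPosition {V : Type*} (G : SimpleGraph V) (X : Set V) : Prop :=
  (∀ u ∈ X, ∀ v ∈ X, G.XPositionable X u v) ∧
    ∀ u ∈ X, ∀ v ∈ Xᶜ, G.XPositionable X u v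

/-- The outer general position number: the largest cardinality of an outer general position set
(for a finite graph). -/
noncomputable def outerGPNumber {V : Type*} (G : SimpleGraph V) : ℕ :=
  sSup {n | ∃ X : Finset V, G.IsOuterGeneralPosition (X : Set V) ∧ X.card = n}

/-- The closed neighborhood `N_G[u]`. -/
def closedNeighborSet {V : Type*} (G : SimpleGraph V) (u : V) : Set V :=
  insert u (G.neighborSet u)

/-- `u` is maximally distant from `v`. -/
def MaximallyDistant {V : Type*} (G : SimpleGraph V) (u v : V) : Prop :=
  ∀ w ∈ G.neighborSet u, G.dist v w ≤ G.dist u v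

/-- `u` and `v` are mutually maximally distant. -/
def MMD {V : Type*} (G : SimpleGraph V) (u v : V) : Prop :=
  G.MaximallyDistant u v ∧ G.MaximallyDistant v u

/-- The boundary: the vertices that are MMD with some other vertex. -/
def mmdBoundary {V : Type*} (G : SimpleGraph V) : Set V :=
  {u | ∃ v, v ≠ u ∧ G.MMD u v}

/-- The TF-boundary: the vertices that are MMD with some boundary vertex that is not a
true twin. -/
def tfBoundary {V : Type*} (G : SimpleGraph V) : Set V :=
  {x | x ∈ G.mmdBoundary ∧ ∃ y ∈ G.mmdBoundary,
    G.MMD x y ∧ G.closedNeighborSet x ≠ G.closedNeighborSet y}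

/-- The strong resolving TF-graph, on the TF-boundary. -/
def strongResolvingTF {V : Type*} (G : SimpleGraph V) : SimpleGraph G.tfBoundary where
  Adj x y := G.MMD x y ∧ G.closedNeighborSet (x : V) ≠ G.closedNeighborSet (y : V)
  symm := ⟨fun _ _ h => ⟨⟨h.1.2, h.1.1⟩, h.2.symm⟩⟩
  loopless := ⟨fun _ h => h.2 rfl⟩

/-- The lexicographic product `G ∘ H`. -/
def lexProd {V W : Type*} (G : SimpleGraph V) (H : SimpleGraph W) : SimpleGraph (V × W) where
  Adj x y := (x.1 = y.1 ∧ H.Adj x.2 y.2) ∨ G.Adj x.1 y.1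
  symm := ⟨fun _ _ h => h.imp (fun h => ⟨h.1.symm, h.2.symm⟩) (fun h => h.symm)⟩
  loopless := ⟨fun _ h => h.elim (fun h => H.irrefl h.2) (fun h => G.irrefl h)⟩

/-- The join of `G` and `H`: their disjoint union together with all edges between them. -/
def graphJoin {V W : Type*} (G : SimpleGraph V) (H : SimpleGraph W) : SimpleGraph (V ⊕ W) :=
  (G ⊕g H) ⊔ completeBipartiteGraph V W

end SimpleGraph

/-! An outer general position set is a set of pairwise MMD vertices (`isOuterGeneralPosition_iff`),
so only MMD pairs of the product matter. In distinct fibers, MMD means that the base vertices are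
MMD and not true twins (`mmd_lexProd_of_ne`); inside a fiber, it means that the `H`-coordinates are
non-adjacent or true twins (`mmd_lexProd_fiber`). An optimal set is thus a clique of the strong
resolving TF-graph times a largest set `T` of the latter kind (`outerGPNumber_lexProd`). In a
connected graph of diameter at most 2 that relation is MMD itself, so `T` has size `outerGPNumber`
of `H` when the diameter is 2, and of the join with a point in every case. -/

namespace SimpleGraph

/-! ### Attaining maximal cardinalities -/

section MaxCard

variable {α : Type*} [Finite α] {P : Finset α → Prop}

lemma card_le_sSup_card {X : Finset α} (hX : P X) :
    X.card ≤ sSup {n | ∃ X : Finset α, P X ∧ X.card = n} := by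
  have := Fintype.ofFinite α
  refine le_csSup ⟨Fintype.card α, ?_⟩ ⟨X, hX, rfl⟩
  rintro _ ⟨Y, -, rfl⟩
  exact Y.card_le_univ

lemma exists_card_eq_sSup_card (h : P ∅) :
    ∃ X, P X ∧ X.card = sSup {n | ∃ X : Finset α, P X ∧ X.card = n} := by
  have := Fintype.ofFinite α
  refine Nat.sSup_mem (s := {n | ∃ X : Finset α, P X ∧ X.card = n}) ⟨_, ∅, h, rfl⟩
    ⟨Fintype.card α, ?_⟩
  rintro _ ⟨Y, -, rfl⟩
  exact Y.card_le_univ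

end MaxCard

variable {V W : Type*}

/-! ### Outer general position as pairwise MMD -/

lemma MMD.symm {G : SimpleGraph V} {u v : V} (h : G.MMD u v) : G.MMD v u := ⟨h.2, h.1⟩

/-- A set is an outer general position set iff its elements are pairwise mutually maximally
distant. -/
lemma isOuterGeneralPosition_iff {G : SimpleGraph V} {X : Set V} :
    G.IsOuterGeneralPosition X ↔ X.Pairwise G.MMD := by
  constructor
  · intro h
    have pos : ∀ u ∈ X, ∀ v, G.XPositionable X u v := fun u hu v => by
      by_cases hv : v ∈ X
      exacts [h.1 u hu v hv, h.2 u hu v hv]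
    have key : ∀ x ∈ X, ∀ u ∈ X, x ≠ u → G.MaximallyDistant x u := by
      intro x hx u hu hne w hw
      rw [mem_neighborSet] at hw
      -- If `w` is farther from `u` than `x` is, a shortest `u,x`-path extended by `w` is again
      -- shortest and has `x` in its interior.
      by_contra! hlt
      -- Unreachable pairs have `dist` 0, so a positive distance gives reachability.
      have hr : G.Reachable u x :=
        (Reachable.of_dist_ne_zero (by omega : G.dist u w ≠ 0)).trans hw.symm.reachable
      obtain ⟨p, hp⟩ := hr.exists_walk_length_eq_dist
      have hlen : (p.concat hw).length = G.dist u w := by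
        apply le_antisymm _ (dist_le _)
        rw [Walk.length_concat, hp, dist_comm]
        omega
      rcases pos u hu w _ hlen x (by simp [Walk.support_concat]) hx with h | h
      · exact hne h
      · exact hw.ne h
    exact fun x hx u hu hne => ⟨key x hx u hu hne, key u hu x hx hne.symm⟩
  · intro h
    have pos : ∀ u ∈ X, ∀ v, G.XPositionable X u v := by
      classical
      intro u hu v p hp x hxp hx
      by_contra! hne
      have hq := p.take_spec hxp
      set q := p.takeUntil x hxp
      set r := p.dropUntil x hxp
      have hlen : q.length + r.length = G.dist u v := by
        rw [← hp, ← hq, Walk.length_append]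
      clear_value q r
      cases r with
      | nil => exact hne.2 rfl
      | @cons _ w _ hxw r =>
        have h1 : G.dist u w ≤ G.dist x u := (h hx hu hne.1).1 w hxw
        have h2 : G.dist x u ≤ q.length := by rw [dist_comm]; exact dist_le q
        have hr : G.Reachable u w := q.reachable.trans hxw.reachable
        -- The successor `w` of `x` on `p` is no farther from `u` than `x`, so reaching `w` by `s`
        -- and then following `r` is shorter than `p`.
        obtain ⟨s, hs⟩ := hr.exists_walk_length_eq_dist
        have h3 := dist_le (s.append r)
        rw [Walk.length_append] at h3
        rw [Walk.length_cons] at hlen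
        omega
    exact ⟨fun u hu v _ => pos u hu v, fun u hu v _ => pos u hu v⟩

lemma card_le_outerGPNumber [Finite V] {G : SimpleGraph V} {X : Finset V}
    (hX : (X : Set V).Pairwise G.MMD) : X.card ≤ G.outerGPNumber :=
  card_le_sSup_card (P := fun X : Finset V => G.IsOuterGeneralPosition (X : Set V))
    (isOuterGeneralPosition_iff.2 hX)

lemma exists_card_eq_outerGPNumber [Finite V] (G : SimpleGraph V) :
    ∃ X : Finset V, (X : Set V).Pairwise G.MMD ∧ X.card = G.outerGPNumber := by
  obtain ⟨X, hX, hc⟩ := exists_card_eq_sSup_card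
    (P := fun X : Finset V => G.IsOuterGeneralPosition (X : Set V))
    (isOuterGeneralPosition_iff.2 (by simp))
  exact ⟨X, isOuterGeneralPosition_iff.1 hX, hc⟩

/-! ### Non-adjacent or twin vertices, and diameter two -/

/-- `u` and `v` are non-adjacent or true twins. -/
def NonadjOrTwins (G : SimpleGraph V) (u v : V) : Prop :=
  G.Adj u v → G.closedNeighborSet u = G.closedNeighborSet v

/-- The largest cardinality of a set whose elements are pairwise non-adjacent or true twins. -/
noncomputable def twinIndepNumber (G : SimpleGraph V) : ℕ :=
  sSup {n | ∃ X : Finset V, (X : Set V).Pairwise G.NonadjOrTwins ∧ X.card = n}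

lemma card_le_twinIndepNumber [Finite V] {G : SimpleGraph V} {X : Finset V}
    (hX : (X : Set V).Pairwise G.NonadjOrTwins) : X.card ≤ G.twinIndepNumber :=
  card_le_sSup_card (P := fun X : Finset V => (X : Set V).Pairwise G.NonadjOrTwins) hX

lemma exists_card_eq_twinIndepNumber [Finite V] (G : SimpleGraph V) :
    ∃ X : Finset V, (X : Set V).Pairwise G.NonadjOrTwins ∧ X.card = G.twinIndepNumber :=
  exists_card_eq_sSup_card (P := fun X : Finset V => (X : Set V).Pairwise G.NonadjOrTwins)
    (by simp)

lemma mem_closedNeighborSet {G : SimpleGraph V} {u v : V} :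
    v ∈ G.closedNeighborSet u ↔ v = u ∨ G.Adj u v := Iff.rfl

lemma adj_of_closedNeighborSet_eq {G : SimpleGraph V} {u v : V} (hne : u ≠ v)
    (h : G.closedNeighborSet u = G.closedNeighborSet v) : G.Adj u v := by
  have : v ∈ G.closedNeighborSet u := h ▸ Or.inl rfl
  exact (mem_closedNeighborSet.1 this).resolve_left hne.symm

lemma mem_closedNeighborSet_iff_dist_le_one {G : SimpleGraph V} {u v : V}
    (h : G.Reachable u v) : v ∈ G.closedNeighborSet u ↔ G.dist u v ≤ 1 := by
  rw [mem_closedNeighborSet, ← dist_eq_one_iff_adj, eq_comm, ← h.dist_eq_zero_iff]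
  omega

/-- Adjacent vertices are mutually maximally distant iff they are true twins. -/
lemma Adj.mmd_iff {G : SimpleGraph V} {u v : V} (h : G.Adj u v) :
    G.MMD u v ↔ G.closedNeighborSet u = G.closedNeighborSet v := by
  have sub : ∀ {u v : V}, G.Adj u v →
      (G.MaximallyDistant u v ↔ G.closedNeighborSet u ⊆ G.closedNeighborSet v) := by
    intro u v h
    have key : ∀ w, G.Adj u w → (G.dist v w ≤ G.dist u v ↔ w ∈ G.closedNeighborSet v) := by
      intro w hw
      rw [mem_closedNeighborSet_iff_dist_le_one (h.symm.reachable.trans hw.reachable),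
        dist_eq_one_iff_adj.2 h]
    constructor
    · rintro hm w (rfl | hw)
      · exact Or.inr h.symm
      · exact (key w hw).1 (hm w hw)
    · exact fun hs w hw => (key w hw).2 (hs (Or.inr hw))
  rw [MMD, sub h, sub h.symm, Set.Subset.antisymm_iff]

/-- Vertices that are mutually maximally distant and not true twins are exactly the
non-adjacent mutually maximally distant ones. -/
lemma MMD.closedNeighborSet_ne_iff {G : SimpleGraph V} {u v : V} (h : G.MMD u v) (hne : u ≠ v) :
    G.closedNeighborSet u ≠ G.closedNeighborSet v ↔ ¬ G.Adj u v :=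
  ⟨fun hn ha => hn (ha.mmd_iff.1 h), fun hn he => hn (adj_of_closedNeighborSet_eq hne he)⟩

/-- Non-adjacent vertices are at distance at least 2, which no neighbor can then exceed; the
adjacent case is `Adj.mmd_iff`. -/
lemma Reachable.mmd_iff_nonadjOrTwins {G : SimpleGraph V} {u v : V} (hr : G.Reachable u v)
    (hne : u ≠ v) (hu : ∀ w, G.Adj u w → G.dist v w ≤ 2) (hv : ∀ w, G.Adj v w → G.dist u w ≤ 2) :
    G.MMD u v ↔ G.NonadjOrTwins u v := by
  by_cases h : G.Adj u v
  · simp [NonadjOrTwins, h, h.mmd_iff]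
  · have h2 := hr.one_lt_dist_of_ne_of_not_adj hne h
    refine iff_of_true ⟨fun w hw => (hu w hw).trans h2, fun w hw => ?_⟩ fun h' => absurd h' h
    rw [dist_comm (u := v)]
    exact (hv w hw).trans h2

lemma outerGPNumber_eq_twinIndepNumber [Finite V] {G : SimpleGraph V} (hG : G.Preconnected)
    (h2 : ∀ u v, G.dist u v ≤ 2) : G.outerGPNumber = G.twinIndepNumber := by
  have key : ∀ u v, u ≠ v → (G.MMD u v ↔ G.NonadjOrTwins u v) := fun u v hne =>
    (hG u v).mmd_iff_nonadjOrTwins hne (fun _ _ => h2 _ _) (fun _ _ => h2 _ _)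
  apply le_antisymm
  · obtain ⟨X, hX, hc⟩ := G.exists_card_eq_outerGPNumber
    exact hc ▸ card_le_twinIndepNumber fun u hu v hv hne => (key u v hne).1 (hX hu hv hne)
  · obtain ⟨X, hX, hc⟩ := G.exists_card_eq_twinIndepNumber
    exact hc ▸ card_le_outerGPNumber fun u hu v hv hne => (key u v hne).2 (hX hu hv hne)

lemma outerGPNumber_of_ediam_eq_two [Finite V] {G : SimpleGraph V} (h : G.ediam = 2) :
    G.outerGPNumber = G.twinIndepNumber := by
  have hpre : G.Preconnected := preconnected_of_ediam_ne_top (by simp [h])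
  refine outerGPNumber_eq_twinIndepNumber hpre fun u v => ?_
  have : (G.dist u v : ℕ∞) ≤ 2 := by
    rw [(hpre u v).coe_dist_eq_edist, ← h]
    exact edist_le_ediam
  exact_mod_cast this

/-! ### The join with a single vertex -/

section Join

variable {H : SimpleGraph W}

lemma graphJoin_adj_inl_inr (u : Unit) (w : W) :
    ((⊤ : SimpleGraph Unit).graphJoin H).Adj (Sum.inl u) (Sum.inr w) := by
  simp [graphJoin]

lemma graphJoin_adj_inr_inr (w w' : W) :
    ((⊤ : SimpleGraph Unit).graphJoin H).Adj (Sum.inr w) (Sum.inr w') ↔ H.Adj w w' := by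
  simp [graphJoin]

lemma isUniversal_inl_graphJoin (u : Unit) : ((⊤ : SimpleGraph Unit).graphJoin H).IsUniversal (Sum.inl u) := by
  rintro (v | w) h
  · exact absurd rfl h
  · exact graphJoin_adj_inl_inr u w

lemma inr_mem_closedNeighborSet_graphJoin (w w' : W) :
    (Sum.inr w' : Unit ⊕ W) ∈ ((⊤ : SimpleGraph Unit).graphJoin H).closedNeighborSet (Sum.inr w) ↔
      w' ∈ H.closedNeighborSet w := by
  rw [mem_closedNeighborSet, mem_closedNeighborSet, graphJoin_adj_inr_inr, Sum.inr.injEq]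

lemma nonadjOrTwins_graphJoin_inr_inr (w w' : W) :
    ((⊤ : SimpleGraph Unit).graphJoin H).NonadjOrTwins (Sum.inr w) (Sum.inr w') ↔ H.NonadjOrTwins w w' := by
  rw [NonadjOrTwins, NonadjOrTwins, graphJoin_adj_inr_inr]
  refine imp_congr_right fun _ => ?_
  simp only [Set.ext_iff, Sum.forall, inr_mem_closedNeighborSet_graphJoin]
  refine and_iff_right fun u => iff_of_true ?_ ?_ <;>
    exact Or.inr (graphJoin_adj_inl_inr _ _).symm

lemma not_nonadjOrTwins_graphJoin (hH : ∀ w, ¬ H.IsUniversal w) (u : Unit) (w : W) :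
    ¬ ((⊤ : SimpleGraph Unit).graphJoin H).NonadjOrTwins (Sum.inl u) (Sum.inr w) := by
  intro h
  apply hH w
  intro w' hne
  have : (Sum.inr w' : Unit ⊕ W) ∈ ((⊤ : SimpleGraph Unit).graphJoin H).closedNeighborSet (Sum.inr w) :=
    h (graphJoin_adj_inl_inr u w) ▸ Or.inr (graphJoin_adj_inl_inr u w')
  exact (((inr_mem_closedNeighborSet_graphJoin w w').1 this).resolve_left hne.symm)

lemma NonadjOrTwins.symm {G : SimpleGraph V} {u v : V} (h : G.NonadjOrTwins u v) :
    G.NonadjOrTwins v u := fun ha => (h ha.symm).symm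

lemma one_le_twinIndepNumber [Finite V] [Nonempty V] (G : SimpleGraph V) :
    1 ≤ G.twinIndepNumber := by
  obtain ⟨v⟩ := ‹Nonempty V›
  simpa using card_le_twinIndepNumber (G := G) (X := {v}) (by simp)

/-- The apex is adjacent to every vertex of `H` but a true twin of none, as `H` has no universal
vertex; an admissible set containing it is a singleton. -/
lemma twinIndepNumber_graphJoin [Finite W] [Nonempty W] (hH : ∀ w, ¬ H.IsUniversal w) :
    ((⊤ : SimpleGraph Unit).graphJoin H).twinIndepNumber = H.twinIndepNumber := by
  classical
  apply le_antisymm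
  · obtain ⟨X, hX, hc⟩ := ((⊤ : SimpleGraph Unit).graphJoin H).exists_card_eq_twinIndepNumber
    rw [← hc]
    by_cases hu : Sum.inl () ∈ X
    · refine le_trans (Finset.card_le_one.2 ?_) H.one_le_twinIndepNumber
      have : ∀ x ∈ X, x = Sum.inl () := by
        rintro (u | w) hx
        · rfl
        · exact absurd (hX hu hx Sum.inl_ne_inr) (not_nonadjOrTwins_graphJoin hH _ _)
      intro a ha b hb
      rw [this a ha, this b hb]
    · have hsub : X ⊆ X.toRight.map Function.Embedding.inr := by
        rintro (u | w) hx
        · exact absurd hx hu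
        · simpa using hx
      refine (Finset.card_le_card hsub).trans ?_
      rw [Finset.card_map]
      apply card_le_twinIndepNumber
      intro w hw w' hw' hne
      exact (nonadjOrTwins_graphJoin_inr_inr w w').1
        (hX (by simpa using hw) (by simpa using hw') (by simpa using hne))
  · obtain ⟨X, hX, hc⟩ := H.exists_card_eq_twinIndepNumber
    rw [← hc, ← Finset.card_map Function.Embedding.inr]
    apply card_le_twinIndepNumber
    simp only [Finset.coe_map]
    rintro _ ⟨w, hw, rfl⟩ _ ⟨w', hw', rfl⟩ hne
    exact (nonadjOrTwins_graphJoin_inr_inr w w').2 (hX hw hw' fun h => hne (by rw [h]))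

lemma outerGPNumber_graphJoin [Finite W] [Nonempty W] (hH : ∀ w, ¬ H.IsUniversal w) :
    ((⊤ : SimpleGraph Unit).graphJoin H).outerGPNumber = H.twinIndepNumber := by
  rw [← twinIndepNumber_graphJoin hH]
  have hu := isUniversal_inl_graphJoin (H := H) ()
  refine outerGPNumber_eq_twinIndepNumber (Connected.of_isUniversal hu).preconnected fun x y => ?_
  have h1 : ∀ z, ((⊤ : SimpleGraph Unit).graphJoin H).dist (Sum.inl ()) z ≤ 1 := fun z => by
    rw [← mem_closedNeighborSet_iff_dist_le_one (Reachable.of_isUniversal z hu)]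
    by_cases h : Sum.inl () = z
    exacts [Or.inl h.symm, Or.inr (hu h)]
  have := (Connected.of_isUniversal hu).dist_triangle (u := x) (v := Sum.inl ()) (w := y)
  have h2 := h1 y
  have h3 := h1 x
  rw [dist_comm] at h3
  omega

end Join

/-! ### Distances and MMD pairs in the lexicographic product -/

section LexProd

variable {G : SimpleGraph V} {H : SimpleGraph W}

lemma Walk.exists_lexProd_length_le {x y : V × W} (p : (G.lexProd H).Walk x y) :
    ∃ q : G.Walk x.1 y.1, q.length ≤ p.length := by
  induction p with
  | nil => exact ⟨.nil, le_rfl⟩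
  | cons h p ih =>
    obtain ⟨q, hq⟩ := ih
    rw [length_cons]
    rcases h with ⟨h, -⟩ | h
    · exact ⟨q.copy h.symm rfl, by rw [length_copy]; omega⟩
    · exact ⟨q.cons h, by simpa using hq⟩

lemma Walk.exists_lexProd_length_eq {g g' : V} (p : G.Walk g g') (hp : 0 < p.length) (h h' : W) :
    ∃ q : (G.lexProd H).Walk (g, h) (g', h'), q.length = p.length := by
  induction p with
  | nil => simp at hp
  | @cons u v w hadj p ih =>
    -- The second coordinate stays `h` until the last edge, which switches it to `h'`.
    rcases Nat.eq_zero_or_pos p.length with h0 | h0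
    · obtain rfl := Walk.eq_of_length_eq_zero h0
      have : (G.lexProd H).Adj (u, h) (v, h') := Or.inr hadj
      exact ⟨.cons this .nil, by simp [h0]⟩
    · obtain ⟨q, hq⟩ := ih h0
      have : (G.lexProd H).Adj (u, h) (v, h) := Or.inr hadj
      exact ⟨.cons this q, by simp [hq]⟩

lemma dist_lexProd_of_ne (hG : G.Connected) {g g' : V} (hne : g ≠ g') (h h' : W) :
    (G.lexProd H).Reachable (g, h) (g', h') ∧
      (G.lexProd H).dist (g, h) (g', h') = G.dist g g' := by
  obtain ⟨p, hp⟩ := hG.exists_walk_length_eq_dist g g'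
  obtain ⟨q, hq⟩ := p.exists_lexProd_length_eq (H := H) (hp ▸ hG.pos_dist_of_ne hne) h h'
  refine ⟨q.reachable, le_antisymm (by rw [← hp, ← hq]; exact dist_le q) ?_⟩
  obtain ⟨r, hr⟩ := q.reachable.exists_walk_length_eq_dist
  obtain ⟨s, hs⟩ := r.exists_lexProd_length_le
  exact (dist_le s).trans (hr ▸ hs)

/-- A detour through an adjacent fiber joins any two points, even if `H` is disconnected. -/
lemma dist_lexProd_fiber (hG : G.Connected) [Nontrivial V] (g : V) (h h' : W) :
    (G.lexProd H).Reachable (g, h) (g, h') ∧ (G.lexProd H).dist (g, h) (g, h') ≤ 2 := by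
  obtain ⟨k, hk⟩ := hG.preconnected.exists_adj_of_nontrivial g
  have h1 : (G.lexProd H).Adj (g, h) (k, h) := Or.inr hk
  have h2 : (G.lexProd H).Adj (k, h) (g, h') := Or.inr hk.symm
  exact ⟨h1.reachable.trans h2.reachable, dist_le (.cons h1 (.cons h2 .nil))⟩

lemma nonadjOrTwins_lexProd_fiber (g : V) (h h' : W) :
    (G.lexProd H).NonadjOrTwins (g, h) (g, h') ↔ H.NonadjOrTwins h h' := by
  have hadj : ∀ a b, (G.lexProd H).Adj (g, a) (g, b) ↔ H.Adj a b := by simp [lexProd]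
  have hmem : ∀ a b, (g, b) ∈ (G.lexProd H).closedNeighborSet (g, a) ↔
      b ∈ H.closedNeighborSet a := by simp [mem_closedNeighborSet, hadj]
  have hmem' : ∀ a k b, k ≠ g →
      ((k, b) ∈ (G.lexProd H).closedNeighborSet (g, a) ↔ G.Adj g k) := by
    intro a k b hk
    simp [mem_closedNeighborSet, lexProd, hk, hk.symm]
  rw [NonadjOrTwins, NonadjOrTwins, hadj]
  refine imp_congr_right fun _ => ⟨fun he => ?_, fun he => ?_⟩
  · ext b
    rw [← hmem, ← hmem, he]
  · ext ⟨k, b⟩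
    by_cases hk : k = g
    · rw [hk, hmem, hmem, he]
    · rw [hmem' _ _ _ hk, hmem' _ _ _ hk]

lemma mmd_lexProd_fiber (hG : G.Connected) [Nontrivial V] (g : V) {h h' : W} (hne : h ≠ h') :
    (G.lexProd H).MMD (g, h) (g, h') ↔ H.NonadjOrTwins h h' := by
  rw [← nonadjOrTwins_lexProd_fiber (G := G) g]
  have key : ∀ a b w, (G.lexProd H).Adj (g, a) w → (G.lexProd H).dist (g, b) w ≤ 2 := by
    rintro a b ⟨k, c⟩ (⟨hk, -⟩ | hk)
    · obtain rfl : g = k := hk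
      exact (dist_lexProd_fiber hG g b c).2
    · have : (G.lexProd H).Adj (g, b) (k, c) := Or.inr hk
      rw [dist_eq_one_iff_adj.2 this]
      exact one_le_two
  exact (dist_lexProd_fiber hG g h h').1.mmd_iff_nonadjOrTwins (by simpa using hne)
    (key h h') (key h' h)

lemma mmd_lexProd_of_ne (hG : G.Connected) (hH : ∀ w, ¬ H.IsUniversal w) {g g' : V}
    (hne : g ≠ g') (h h' : W) :
    (G.lexProd H).MMD (g, h) (g', h') ↔
      G.MMD g g' ∧ G.closedNeighborSet g ≠ G.closedNeighborSet g' := by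
  have hnt : Nontrivial V := ⟨g, g', hne⟩
  constructor
  · intro hm
    have hnadj : ¬ G.Adj g g' := by
      intro ha
      -- Adjacent MMD vertices are true twins, but `(g', h')` sees the whole fiber of `g`, while
      -- `(g, h)` misses `(g, k)`.
      obtain ⟨k, hk, hnk⟩ : ∃ k, h ≠ k ∧ ¬ H.Adj h k := by
        simpa [IsUniversal] using hH h
      have hadj : (G.lexProd H).Adj (g, h) (g', h') := Or.inr ha
      have hk' : (g, k) ∈ (G.lexProd H).closedNeighborSet (g, h) := by
        rw [hadj.mmd_iff.1 hm]
        exact Or.inr (Or.inr ha.symm)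
      simp [mem_closedNeighborSet, lexProd, hk.symm, hnk] at hk'
    have key : ∀ {g g' : V} {h h' : W}, g ≠ g' → ¬ G.Adj g g' →
        (G.lexProd H).MaximallyDistant (g, h) (g', h') → G.MaximallyDistant g g' := by
      intro g g' h h' hne hn hm w hw
      have hw' : (G.lexProd H).Adj (g, h) (w, h) := Or.inr hw
      -- Distances are those of `G` only between distinct fibers; non-adjacency keeps `w` away from
      -- `g'`.
      have hwne : g' ≠ w := by rintro rfl; exact hn hw
      have := hm (w, h) hw'
      rwa [(dist_lexProd_of_ne hG hne _ _).2, (dist_lexProd_of_ne hG hwne _ _).2] at this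
    have hm' : G.MMD g g' :=
      ⟨key hne hnadj hm.1, key hne.symm (fun h => hnadj h.symm) hm.2⟩
    exact ⟨hm', (hm'.closedNeighborSet_ne_iff hne).2 hnadj⟩
  · rintro ⟨hm, hc⟩
    have hnadj := (hm.closedNeighborSet_ne_iff hne).1 hc
    have key : ∀ {g g' : V} {h h' : W}, g ≠ g' → ¬ G.Adj g g' →
        G.MaximallyDistant g g' → (G.lexProd H).MaximallyDistant (g, h) (g', h') := by
      rintro g g' h h' hne hn hm ⟨w, k⟩ (⟨hw, -⟩ | hw)
      · obtain rfl : g = w := hw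
        rw [(dist_lexProd_of_ne hG hne _ _).2, (dist_lexProd_of_ne hG hne.symm _ _).2, dist_comm]
      · have hwne : g' ≠ w := by rintro rfl; exact hn hw
        rw [(dist_lexProd_of_ne hG hne _ _).2, (dist_lexProd_of_ne hG hwne _ _).2]
        exact hm w hw
    exact ⟨key hne hnadj hm.1, key hne.symm (fun h => hnadj h.symm) hm.2⟩

end LexProd

/-! ### Cliques of the strong resolving TF-graph -/

lemma MMD.mem_tfBoundary {G : SimpleGraph V} {x y : V} (h : G.MMD x y)
    (hc : G.closedNeighborSet x ≠ G.closedNeighborSet y) : x ∈ G.tfBoundary := by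
  have hne : x ≠ y := fun he => hc (by rw [he])
  exact ⟨⟨y, hne.symm, h⟩, y, ⟨x, hne, h.symm⟩, h, hc⟩

/-- A connected non-complete finite graph has vertices that are mutually maximally distant and
not true twins, for example two vertices at maximal distance. -/
lemma tfBoundary_nonempty [Finite V] {G : SimpleGraph V} (hG : G.Connected) (hGc : G ≠ ⊤) :
    G.tfBoundary.Nonempty := by
  obtain ⟨a, b, hab, hnab⟩ : ∃ a b, a ≠ b ∧ ¬ G.Adj a b := by
    by_contra! h
    exact hGc (by ext a b; exact ⟨fun h => h.ne, h a b⟩)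
  have : Nonempty V := ⟨a⟩
  obtain ⟨⟨u, v⟩, huv⟩ := Finite.exists_max fun p : V × V => G.dist p.1 p.2
  have hmax : ∀ c d, G.dist c d ≤ G.dist u v := fun c d => huv (c, d)
  have h2 : 1 < G.dist u v :=
    (hG.one_lt_dist_of_ne_of_not_adj hab hnab).trans_le (hmax a b)
  have hm : G.MMD u v := ⟨fun w _ => hmax v w, fun w _ => (hmax u w).trans_eq dist_comm⟩
  have hne : u ≠ v := by rintro rfl; simp at h2
  have hn : ¬ G.Adj u v := fun h => by rw [dist_eq_one_iff_adj.2 h] at h2; omega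
  exact ⟨u, hm.mem_tfBoundary ((hm.closedNeighborSet_ne_iff hne).2 hn)⟩

/-- A clique of the relation "mutually maximally distant and not true twins" has at most
`ω(G'_SRS)` elements. -/
lemma card_le_cliqueNum_strongResolvingTF [Finite V] {G : SimpleGraph V} (hG : G.Connected)
    (hGc : G ≠ ⊤) {C : Finset V}
    (hC : (C : Set V).Pairwise fun x y =>
      G.MMD x y ∧ G.closedNeighborSet x ≠ G.closedNeighborSet y) :
    C.card ≤ G.strongResolvingTF.cliqueNum := by
  classical
  -- A singleton `C` may lie outside the TF-boundary, so its bound needs a boundary vertex from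
  -- elsewhere.
  rcases le_or_gt C.card 1 with h1 | h1
  · obtain ⟨x, hx⟩ := tfBoundary_nonempty hG hGc
    refine h1.trans ?_
    have : G.strongResolvingTF.IsClique (({⟨x, hx⟩} : Finset G.tfBoundary) : Set _) := by simp
    simpa using this.card_le_cliqueNum
  · have hsub : ∀ x ∈ C, x ∈ G.tfBoundary := by
      intro x hx
      obtain ⟨y, hy, hne⟩ := Finset.exists_mem_ne h1 x
      obtain ⟨hm, hc⟩ := hC hx hy hne.symm
      exact hm.mem_tfBoundary hc
    have hcl : G.strongResolvingTF.IsClique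
        ((C.subtype (· ∈ G.tfBoundary) : Finset G.tfBoundary) : Set _) := by
      intro x hx y hy hne
      exact hC (by simpa using hx) (by simpa using hy) (Subtype.coe_injective.ne hne)
    have hcard : (C.subtype (· ∈ G.tfBoundary)).card = C.card := by
      rw [Finset.card_subtype, Finset.filter_true_of_mem hsub]
    exact hcard ▸ hcl.card_le_cliqueNum

/-! ### Counting by fibers -/

theorem outerGPNumber_lexProd [Finite V] [Finite W] {G : SimpleGraph V} {H : SimpleGraph W}
    (hG : G.Connected) (hGc : G ≠ ⊤) (hH : ∀ w, ¬ H.IsUniversal w) :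
    (G.lexProd H).outerGPNumber = G.strongResolvingTF.cliqueNum * H.twinIndepNumber := by
  classical
  have hnt : Nontrivial V := by
    by_contra h
    rw [not_nontrivial_iff_subsingleton] at h
    exact hGc (Subsingleton.elim _ _)
  apply le_antisymm
  · obtain ⟨X, hX, hc⟩ := (G.lexProd H).exists_card_eq_outerGPNumber
    rw [← hc, mul_comm]
    -- The projection of `X` to `G` bounds the number of fibers met, and `H.twinIndepNumber` bounds
    -- each fiber.
    refine (Finset.card_le_mul_card_image (f := Prod.fst) X H.twinIndepNumber ?_).trans
      (Nat.mul_le_mul_left _ (card_le_cliqueNum_strongResolvingTF hG hGc ?_))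
    · intro g _
      have hinj : Set.InjOn Prod.snd (({x ∈ X | x.1 = g} : Finset (V × W)) : Set (V × W)) := by
        rintro ⟨a, b⟩ h ⟨c, d⟩ h' he
        simp only [Finset.coe_filter, Set.mem_ofPred_eq] at h h' he
        exact Prod.ext (h.2.trans h'.2.symm) he
      rw [← Finset.card_image_of_injOn hinj]
      apply card_le_twinIndepNumber
      intro h hh h' hh' hne
      have hh : (g, h) ∈ X := by simpa using hh
      have hh' : (g, h') ∈ X := by simpa using hh'
      exact (mmd_lexProd_fiber hG g hne).1 (hX hh hh' (by simpa using hne))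
    · intro g hg g' hg' hne
      obtain ⟨⟨a, h⟩, hx, rfl⟩ := Finset.mem_image.1 hg
      obtain ⟨⟨b, h'⟩, hx', rfl⟩ := Finset.mem_image.1 hg'
      exact (mmd_lexProd_of_ne hG hH hne h h').1
        (hX hx hx' fun he => hne (congrArg Prod.fst he))
  · obtain ⟨C, hC⟩ := G.strongResolvingTF.exists_isNClique_cliqueNum
    obtain ⟨T, hT, hTc⟩ := H.exists_card_eq_twinIndepNumber
    rw [← hC.card_eq, ← hTc, ← Finset.card_map (Function.Embedding.subtype _) (s := C),
      ← Finset.card_product]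
    apply card_le_outerGPNumber
    rintro ⟨g, h⟩ hx ⟨g', h'⟩ hy hne
    obtain ⟨hg, hh⟩ := Finset.mem_product.1 hx
    obtain ⟨hg', hh'⟩ := Finset.mem_product.1 hy
    obtain ⟨c, hc, rfl⟩ := Finset.mem_map.1 hg
    obtain ⟨c', hc', rfl⟩ := Finset.mem_map.1 hg'
    by_cases he : c = c'
    · subst he
      have hne' : h ≠ h' := fun e => hne (Prod.ext rfl e)
      exact (mmd_lexProd_fiber hG _ hne').2 (hT hh hh' hne')
    · exact (mmd_lexProd_of_ne hG hH (Subtype.coe_injective.ne he) h h').2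
        (hC.isClique hc hc' he)

end SimpleGraph

theorem mainTheorem7 {V W : Type*} [Finite V] [Finite W]
    (G : SimpleGraph V) (H : SimpleGraph W)
    (hG : G.Connected) (hGc : G ≠ ⊤)
    (hH : 2 ≤ Nat.card W) (hHu : ∀ h : W, ¬ H.IsUniversal h) :
    (H.ediam = 2 →
      (G.lexProd H).outerGPNumber = G.strongResolvingTF.cliqueNum * H.outerGPNumber) ∧
    (2 < H.ediam →
      (G.lexProd H).outerGPNumber =
        G.strongResolvingTF.cliqueNum *
          ((⊤ : SimpleGraph Unit).graphJoin H).outerGPNumber) := by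
  have : Nonempty W := (Nat.card_pos_iff.1 (by omega)).1
  rw [SimpleGraph.outerGPNumber_lexProd hG hGc hHu, SimpleGraph.outerGPNumber_graphJoin hHu]
  exact ⟨fun h => by rw [SimpleGraph.outerGPNumber_of_ediam_eq_two h], fun _ => rfl⟩
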